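/- **Proposition 1.** Let $\lambda_b, R_{\max}, r_0>0$, and let the base stations (BSs) form a Poisson point process in the plane of density $\lambda_b$ on the disk $\mathcal A=\boldsymbol b(\boldsymbol o,R_{\max})$ and with no points outside it. Let $p_B:[0,\infty)\to[0,1]$ be a measurable function (for instance $p_B(l)=1-e^{-\lambda (l-r_B)^+ r_B}$ with $\lambda,r_B\ge 0$). Consider a mobile user (MU) at distance $r$ from the origin, $0\le r\le R_{\max}$; conditionally on the BS locations, each BS is line-of-sight (LOS) independently of the others, with probability $1-p_B(l)$ if its distance to the MU is $l$. For $R_{\max}-r<l<R_{\max}+r$ put $$\delta(l,r)=\tfrac14\sqrt{(r+R_{\max}+l)(r+R_{\max}-l)(r-R_{\max}+l)(-r+R_{\max}+l)},$$ $$x_{1,2}(l,r)=\pm\frac{2\delta(l,r)}{r},\qquad y_1(l,r)=y_2(l,r)=\frac r2+\frac{R_{\max}^2-l^2}{2r},\qquad m_i(l,r)=\frac{y_i-r}{x_i}\quad(i=1,2),$$ $$\theta(l,r)=\pi+\tan^{-1}m_1-\tan^{-1}m_2 ,$$ and put $\theta(l,r)=0$ for $l\ge R_{\max}+r$. Let $C(l,r)=\theta(l,r)\,l$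 for $l>R_{\max}-r$. Then: 1. For $R_{\max}-r<l<R_{\max}+r$ the circle of radius $R_{\max}$ about the origin and the circle of radius $l$ about $(0,r)$ meet exactly in the points $(x_1,y_1)$ and $(x_2,y_2)$; moreover $\theta(l,r)\in(0,2\pi)$, and $\tan\theta(l,r)=\frac{m_1-m_2}{1+m_1m_2}$ whenever $1+m_1m_2\neq0$. 2. The length of the part of the circle of radius $l$ about the MU that lies in $\mathcal A$ is $2\pi l$ if $0\le l\le R_{\max}-r$, and $C(l,r)$ if $l>R_{\max}-r$. 3. The probability that the MU has at least one LOS BS within distance $r_0$ is $$B_L(r)=\begin{cases}1-\exp\Big(-2\pi\lambda_b\int_0^{r_0}v(1-p_B(v))\,dv\Big) & \text{if } 0\le r\le R_{\max}-r_0,\\[1mm] 1-\exp\Big(-\lambda_b\Big[2\pi\int_0^{R_{\max}-r}v(1-p_B(v))\,dv+\int_{R_{\max}-r}^{r_0}C(v,r)(1-p_B(v))\,dv\Big]\Big) & \text{otherwise.}\end{cases}$$ 4. If $B_L(r)>0$ then, conditionally on the event that the MU has an LOS BS within distance $r_0$, the distance from the MU to the nearest LOS BS has the probability density, on $0\le l\le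 r_0$, $$f_L(l,r)=\begin{cases}\dfrac{2\pi l\lambda_b(1-p_B(l))}{B_L(r)}\exp\Big(-2\pi\lambda_b\int_0^{l}v(1-p_B(v))\,dv\Big) & \text{if } 0\le r\le R_{\max}-r_0 \text{ or } 0\le l\le R_{\max}-r,\\[2mm] \dfrac{\lambda_bC(l,r)(1-p_B(l))}{B_L(r)}\exp\Big(-\lambda_b\Big[2\pi\int_0^{R_{\max}-r}v(1-p_B(v))\,dv+\int_{R_{\max}-r}^{l}C(v,r)(1-p_B(v))\,dv\Big]\Big) & \text{otherwise.}\end{cases}$$ -/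

import Mathlib

open MeasureTheory ProbabilityTheory
open scoped ENNReal

noncomputable section

namespace MmWave

/-- The plane with its Euclidean norm. -/
abbrev Plane : Type := EuclideanSpace ℝ (Fin 2)

/-! ### Point processes with finitely many points, and their marks

A point process with finitely many points is given by the number `N` of points and an enumeration
`X 0, …, X (N - 1)` of them; the values `X i` with `i ≥ N` play no role. -/

/-- The number of points that lie in the set `A`. -/
def count {Ω E : Type*} (N : Ω → ℕ) (X : ℕ → Ω → E) (A : Set E) (ω : Ω) : ℕ :=
  Set.ncard {i : ℕ | i < N ω ∧ X i ω ∈ A}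

/-- The points `X 0, …, X (N - 1)` form a Poisson point process with finite intensity measure
`Λ`: the number of points in a measurable set `A` has the Poisson law of mean `Λ A`, and the
numbers of points in pairwise disjoint measurable sets are independent. -/
structure IsPoissonProcess {Ω E : Type*} [MeasurableSpace Ω] [MeasurableSpace E]
    (μ : Measure Ω) (N : Ω → ℕ) (X : ℕ → Ω → E) (Λ : Measure E) : Prop where
  measurable_number : Measurable N
  measurable_point : ∀ i, Measurable (X i)
  map_count : ∀ A : Set E, MeasurableSet A →
    μ.map (count N X A) = poissonMeasure (Λ A).toNNReal
  indep_count : ∀ (k : ℕ) (A : Fin k → Set E), (∀ j, MeasurableSet (A j)) →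
    Pairwise (fun i j => Disjoint (A i) (A j)) →
    iIndepFun (fun j => count N X (A j)) μ

/-- Conditionally on the points, the marks `M 0, …, M (N - 1)` are independent and `M i` is `true`
with probability `q (X i)`. -/
structure IsIndependentMarking {Ω E : Type*} [MeasurableSpace Ω] [MeasurableSpace E]
    (μ : Measure Ω) (N : Ω → ℕ) (X : ℕ → Ω → E) (q : E → ℝ) (M : ℕ → Ω → Bool) : Prop where
  measurable_mark : ∀ i, Measurable (M i)
  joint_law : ∀ (n : ℕ) (B : Set (Fin n → E)) (s : Fin n → Bool), MeasurableSet B →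
    μ {ω | N ω = n ∧ (fun i : Fin n => X i ω) ∈ B ∧ ∀ i : Fin n, M i ω = s i} =
      ∫⁻ ω in {ω | N ω = n ∧ (fun i : Fin n => X i ω) ∈ B},
        ∏ i : Fin n, ENNReal.ofReal (if s i = true then q (X i ω) else 1 - q (X i ω)) ∂μ

/-! ### Blockage -/

/-- `pB l` is the blockage probability of a link of length `l ≥ 0`. -/
structure IsBlockageProfile (pB : ℝ → ℝ) : Prop where
  measurable : Measurable pB
  mem_Icc : ∀ l, 0 ≤ l → pB l ∈ Set.Icc (0 : ℝ) 1

/-- The blockage probability `1 - exp (-lam (l - rB) rB)` caused by blockers of density `lam` and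
radius `rB`; a link shorter than `rB` is not blocked. -/
def blockageProb (lam rB l : ℝ) : ℝ :=
  1 - Real.exp (-(lam * max (l - rB) 0 * rB))

theorem isBlockageProfile_blockageProb {lam rB : ℝ} (hlam : 0 ≤ lam) (hrB : 0 ≤ rB) :
    IsBlockageProfile (blockageProb lam rB) where
  measurable := by unfold blockageProb; fun_prop
  mem_Icc l _ := by
    have h : 0 ≤ lam * max (l - rB) 0 * rB :=
      mul_nonneg (mul_nonneg hlam (le_max_right _ _)) hrB
    have h1 : Real.exp (-(lam * max (l - rB) 0 * rB)) ≤ 1 :=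
      Real.exp_le_one_iff.mpr (neg_nonpos.mpr h)
    have h2 := Real.exp_pos (-(lam * max (l - rB) 0 * rB))
    constructor <;> unfold blockageProb <;> linarith

/-! ### The nearest line-of-sight base station -/

/-- The distances from `u` to the base stations with mark `true` (line of sight). -/
def losDistances {Ω : Type*} (N : Ω → ℕ) (X : ℕ → Ω → Plane) (LOS : ℕ → Ω → Bool) (u : Plane)
    (ω : Ω) : Set ℝ :=
  {d | ∃ i, i < N ω ∧ LOS i ω = true ∧ dist u (X i ω) = d}

/-- The event that some line-of-sight base station lies within distance `r₀` of `u`. -/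
def losInRange {Ω : Type*} (N : Ω → ℕ) (X : ℕ → Ω → Plane) (LOS : ℕ → Ω → Bool) (u : Plane)
    (r₀ : ℝ) : Set Ω :=
  {ω | ∃ d ∈ losDistances N X LOS u ω, d ≤ r₀}

/-- The distance from `u` to the nearest line-of-sight base station. The infimum is over a finite
set, so it is a minimum whenever such a base station exists. -/
def nearestLosDist {Ω : Type*} (N : Ω → ℕ) (X : ℕ → Ω → Plane) (LOS : ℕ → Ω → Bool) (u : Plane)
    (ω : Ω) : ℝ :=
  sInf (losDistances N X LOS u ω)

/-! ### The geometry of two circles -/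

/-- The length of the part of the circle of centre `u` and radius `l` that lies in the disk of
centre `0` and radius `R`: the circle is parametrized by the angle, and the length is `l` times
the measure of the set of admissible angles. -/
def arcLengthInDisk (R : ℝ) (u : Plane) (l : ℝ) : ℝ :=
  l * volume.real {φ : ℝ | φ ∈ Set.Ioc (-Real.pi) Real.pi ∧
    u + l • (!₂[Real.cos φ, Real.sin φ] : Plane) ∈ Metric.closedBall (0 : Plane) R}

/-- The area of a triangle with sides `r`, `R`, `l`. -/
def delta (R l r : ℝ) : ℝ :=
  √((r + R + l) * (r + R - l) * (r - R + l) * (-r + R + l)) / 4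

/-- The abscissas of the two intersection points of the circle of centre `0` and radius `R` with
the circle of centre `(0, r)` and radius `l`. -/
def x₁ (R l r : ℝ) : ℝ := 2 * delta R l r / r

def x₂ (R l r : ℝ) : ℝ := -(2 * delta R l r / r)

/-- The common ordinate of the two intersection points. -/
def y₁₂ (R l r : ℝ) : ℝ := r / 2 + (R ^ 2 - l ^ 2) / (2 * r)

/-- The slopes of the lines from `(0, r)` to the two intersection points. -/
def m₁ (R l r : ℝ) : ℝ := (y₁₂ R l r - r) / x₁ R l r

def m₂ (R l r : ℝ) : ℝ := (y₁₂ R l r - r) / x₂ R l r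

/-- The angle of the arc inside the disk. For `R - r < l < R + r` it is the branch in `(0, 2π)` of
`arctan ((m₁ - m₂) / (1 + m₁ m₂))` that is continuous in `l`; for `l ≥ R + r` no arc is left. -/
def theta (R l r : ℝ) : ℝ :=
  if l < R + r then Real.pi + Real.arctan (m₁ R l r) - Real.arctan (m₂ R l r) else 0

/-- The length of the arc of angle `theta`. -/
def C (R l r : ℝ) : ℝ := theta R l r * l

/-! ### The density -/

/-- The probability of a line-of-sight base station within range `r₀`. -/
def B_L (lamb R r₀ : ℝ) (pB : ℝ → ℝ) (r : ℝ) : ℝ :=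
  if r ≤ R - r₀ then
    1 - Real.exp (-(2 * Real.pi * lamb * ∫ v in (0 : ℝ)..r₀, v * (1 - pB v)))
  else
    1 - Real.exp (-(lamb * ((2 * Real.pi * ∫ v in (0 : ℝ)..(R - r), v * (1 - pB v)) +
      ∫ v in (R - r)..r₀, C R v r * (1 - pB v))))

/-- The density of the distance to the nearest line-of-sight base station, for a user at distance
`r` from the origin. -/
def f_L (lamb R r₀ : ℝ) (pB : ℝ → ℝ) (l r : ℝ) : ℝ :=
  if r ≤ R - r₀ ∨ l ≤ R - r then
    2 * Real.pi * l * lamb * (1 - pB l) *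
      Real.exp (-(2 * Real.pi * lamb * ∫ v in (0 : ℝ)..l, v * (1 - pB v))) / B_L lamb R r₀ pB r
  else
    lamb * C R l r * (1 - pB l) *
      Real.exp (-(lamb * ((2 * Real.pi * ∫ v in (0 : ℝ)..(R - r), v * (1 - pB v)) +
        ∫ v in (R - r)..l, C R v r * (1 - pB v)))) / B_L lamb R r₀ pB r

end MmWave

end

noncomputable section

namespace MmWave

/-! Independent thinning keeps a Poisson process Poisson, so the distances from the user to the LOS
stations behave like a Poisson process on the half-line whose intensity `losRate` at `v` is density
times arc length times LOS probability. With `k` this intensity, there is no LOS station within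
distance `t` with probability `exp (-∫₀ᵗ k)`; `B_L` is the complement at `r₀`, and `f_L` is `k l *
exp (-∫₀ˡ k) / B_L`.

The thinned process is never constructed, since void probabilities suffice. Given the points, no LOS
point lies in `S` with probability `∏ (1 - 1_S q) (X i)`, and the generating functional
`IsPoissonProcess.integral_prod` gives the mean of this product. Polar coordinates around the user
(`lintegral_disk_radial`) turn the resulting planar integral into `∫ k`.

The arc length comes from the law of cosines: a direction is admissible when the cosine of its angle
to the outward direction is at most `cosAngle`, which leaves angles of measure `2π - 2 arccos
(cosAngle)`. Heron's formula identifies this with `theta`. As `pB` is merely measurable, `exp (-∫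
k)` is recovered from its derivative through absolute continuity. -/

/-! ### Generating functional of a finite Poisson process -/

theorem integral_pow_poissonMeasure (a : NNReal) (c : ℝ) :
    ∫ n, c ^ n ∂(poissonMeasure a) = Real.exp (a * (c - 1)) := by
  rw [integral_poissonMeasure]
  have h : ∀ n : ℕ, (Real.exp (-a) * (a : ℝ) ^ n / n.factorial) • c ^ n =
      Real.exp (-a) * ((a * c) ^ n / n.factorial) := fun n => by
    rw [smul_eq_mul, mul_pow]; ring
  simp_rw [h]
  rw [tsum_mul_left, ← congrFun (NormedSpace.exp_eq_tsum_div (𝔸 := ℝ)) (a * c),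
    ← Real.exp_eq_exp_ℝ, ← Real.exp_add]
  ring_nf

/-- Points are grouped by the value of `g`; the fibres are disjoint, so for a Poisson process the
exponents are independent. -/
theorem prod_range_eq_prod_pow_count {Ω E : Type*} [MeasurableSpace E] (N : Ω → ℕ)
    (X : ℕ → Ω → E) (g : SimpleFunc E ℝ) (ω : Ω) :
    ∏ i ∈ Finset.range (N ω), g (X i ω) =
      ∏ c ∈ g.range, c ^ count N X (g ⁻¹' {c}) ω := by
  classical
  rw [← Finset.prod_fiberwise_of_maps_to (t := g.range) (g := fun i => g (X i ω))
    (fun i _ => SimpleFunc.mem_range_self g _)]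
  refine Finset.prod_congr rfl fun c _ => ?_
  rw [Finset.prod_congr rfl (fun i hi => (Finset.mem_filter.mp hi).2), Finset.prod_const]
  congr 1
  rw [count, ← Set.ncard_coe_finset]
  congr 1
  ext i
  simp

section

variable {Ω E : Type*} [MeasurableSpace Ω] [MeasurableSpace E] {μ : Measure Ω}
  {N : Ω → ℕ} {X : ℕ → Ω → E} {Λ : Measure E}

/-- Measurability is forced by the law: `Measure.map` along a map that is not a.e. measurable is
zero, whereas a Poisson law is not. -/
theorem IsPoissonProcess.aemeasurable_count (h : IsPoissonProcess μ N X Λ) {A : Set E}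
    (hA : MeasurableSet A) : AEMeasurable (count N X A) μ := by
  by_contra hc
  have h1 := h.map_count A hA
  rw [Measure.map_of_not_aemeasurable hc] at h1
  exact NeZero.ne (poissonMeasure (Λ A).toNNReal) h1.symm

theorem integral_simpleFunc_sub_one [IsFiniteMeasure Λ] (g : SimpleFunc E ℝ) :
    ∫ x, (g x - 1) ∂Λ = ∑ c ∈ g.range, Λ.real (g ⁻¹' {c}) * (c - 1) := by
  have h : ∀ x, g x - 1 = ∑ c ∈ g.range, (g ⁻¹' {c}).indicator (fun _ => c - 1) x := fun x => by
    rw [Finset.sum_eq_single (g x)]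
    · simp
    · intro b _ hb
      simp [Set.indicator, hb.symm]
    · intro hx; exact absurd (SimpleFunc.mem_range_self g x) hx
  simp_rw [h]
  rw [integral_finsetSum]
  · refine Finset.sum_congr rfl fun c _ => ?_
    rw [integral_indicator_const _ (g.measurableSet_preimage _), smul_eq_mul]
  · intro c _
    exact (integrable_const _).indicator (g.measurableSet_preimage _)

theorem IsPoissonProcess.integral_prod_simpleFunc [IsFiniteMeasure Λ]
    (h : IsPoissonProcess μ N X Λ) (g : SimpleFunc E ℝ) :
    ∫ ω, ∏ i ∈ Finset.range (N ω), g (X i ω) ∂μ = Real.exp (∫ x, (g x - 1) ∂Λ) := by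
  -- The values are enumerated by `Fin` to match the form of `indep_count`.
  let e := g.range.equivFin
  let c : Fin g.range.card → ℝ := fun j => e.symm j
  have hprod : ∀ φ : ℝ → ℝ, ∏ a ∈ g.range, φ a = ∏ j, φ (c j) := fun φ => by
    rw [← Finset.prod_coe_sort]
    exact (Equiv.prod_comp e.symm (fun a : g.range => φ a)).symm
  have hind := h.indep_count _ (fun j => g ⁻¹' {c j}) (fun j => g.measurableSet_preimage _) (by
    intro i j hij
    refine Disjoint.preimage _ (Set.disjoint_singleton.mpr fun hc => hij ?_)
    exact e.symm.injective (Subtype.ext hc))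
  simp_rw [prod_range_eq_prod_pow_count, hprod (fun a => a ^ count N X (g ⁻¹' {a}) _)]
  rw [hind.integral_fun_prod_comp (f := fun j n => c j ^ n)
    (fun j => h.aemeasurable_count (g.measurableSet_preimage _))
    (fun j => Measurable.of_discrete.aestronglyMeasurable)]
  have hone : ∀ j, ∫ ω, c j ^ count N X (g ⁻¹' {c j}) ω ∂μ =
      Real.exp (Λ.real (g ⁻¹' {c j}) * (c j - 1)) := fun j => by
    rw [← integral_map (f := fun n : ℕ => c j ^ n)
      (h.aemeasurable_count (g.measurableSet_preimage _))
      Measurable.of_discrete.aestronglyMeasurable,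
      h.map_count _ (g.measurableSet_preimage _), integral_pow_poissonMeasure]
    rfl
  simp_rw [hone]
  rw [← hprod (fun a => Real.exp (Λ.real (g ⁻¹' {a}) * (a - 1))), ← Real.exp_sum,
    integral_simpleFunc_sub_one]

theorem measurable_prod_range {N : Ω → ℕ} (hN : Measurable N) {Y : ℕ → Ω → ℝ}
    (hY : ∀ i, Measurable (Y i)) :
    Measurable fun ω => ∏ i ∈ Finset.range (N ω), Y i ω := by
  have h : Measurable fun p : ℕ × Ω => ∏ i ∈ Finset.range p.1, Y i p.2 :=
    measurable_from_prod_countable_right fun n => by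
      exact Finset.measurable_fun_prod (Finset.range n) fun i _ => hY i
  exact h.comp (hN.prodMk measurable_id)

/-- The generating functional of a Poisson point process. -/
theorem IsPoissonProcess.integral_prod [IsProbabilityMeasure μ] [IsFiniteMeasure Λ]
    (h : IsPoissonProcess μ N X Λ) {g : E → ℝ} (hg : Measurable g)
    (h01 : ∀ x, g x ∈ Set.Icc (0 : ℝ) 1) :
    ∫ ω, ∏ i ∈ Finset.range (N ω), g (X i ω) ∂μ = Real.exp (∫ x, (g x - 1) ∂Λ) := by
  have h0 : (0 : ℝ) ∈ Set.Icc (0 : ℝ) 1 := ⟨le_rfl, zero_le_one⟩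
  -- The approximants stay in `[0, 1]`, so the constant 1 dominates both the products and `G n - 1`.
  let G : ℕ → SimpleFunc E ℝ := SimpleFunc.approxOn g hg (Set.Icc 0 1) 0 h0
  have hG01 : ∀ n x, G n x ∈ Set.Icc (0 : ℝ) 1 := SimpleFunc.approxOn_mem hg h0
  have hGlim : ∀ x, Filter.Tendsto (fun n => G n x) Filter.atTop (nhds (g x)) := fun x =>
    SimpleFunc.tendsto_approxOn hg h0 (subset_closure (h01 x))
  have hl : Filter.Tendsto (fun n => ∫ ω, ∏ i ∈ Finset.range (N ω), G n (X i ω) ∂μ)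
      Filter.atTop (nhds (∫ ω, ∏ i ∈ Finset.range (N ω), g (X i ω) ∂μ)) := by
    refine tendsto_integral_of_dominated_convergence (fun _ => 1) (fun n => ?_)
      (integrable_const _) (fun n => ?_) ?_
    · exact (measurable_prod_range h.measurable_number
        fun i => (G n).measurable.comp (h.measurable_point i)).aestronglyMeasurable
    · refine Filter.Eventually.of_forall fun ω => ?_
      rw [Real.norm_of_nonneg (Finset.prod_nonneg fun i _ => (hG01 n _).1)]
      exact Finset.prod_le_one (fun i _ => (hG01 n _).1) fun i _ => (hG01 n _).2
    · exact Filter.Eventually.of_forall fun ω => tendsto_finsetProd _ fun i _ => hGlim _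
  have hr : Filter.Tendsto (fun n => Real.exp (∫ x, (G n x - 1) ∂Λ))
      Filter.atTop (nhds (Real.exp (∫ x, (g x - 1) ∂Λ))) := by
    refine (Real.continuous_exp.tendsto _).comp ?_
    refine tendsto_integral_of_dominated_convergence (fun _ => 1) (fun n => ?_)
      (integrable_const _) (fun n => ?_) ?_
    · exact ((G n).measurable.sub_const 1).aestronglyMeasurable
    · refine Filter.Eventually.of_forall fun x => ?_
      rw [Real.norm_eq_abs, abs_le]
      constructor <;> linarith [(hG01 n x).1, (hG01 n x).2]
    · exact Filter.Eventually.of_forall fun x => (hGlim x).sub_const 1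
  simp_rw [h.integral_prod_simpleFunc] at hl
  exact tendsto_nhds_unique hl hr

/-! ### Void probabilities of the marked process -/

theorem measurableSet_forall_notMem {M : ℕ → Ω → Bool} (hN : Measurable N)
    (hX : ∀ i, Measurable (X i)) (hM : ∀ i, Measurable (M i)) {S : Set E}
    (hS : MeasurableSet S) :
    MeasurableSet {ω | ∀ i < N ω, M i ω = true → X i ω ∉ S} := by
  have : {ω | ∀ i < N ω, M i ω = true → X i ω ∉ S} =
      ⋂ i, ({ω | i < N ω} ∩ (M i ⁻¹' {true} ∩ X i ⁻¹' S))ᶜ := by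
    ext ω; simp
  rw [this]
  exact MeasurableSet.iInter fun i => ((measurableSet_lt measurable_const hN).inter
    ((hM i (measurableSet_singleton _)).inter (hX i hS))).compl

/-- Conditionally on the points, the probability that none of them is marked `true` in `S`. -/
theorem IsIndependentMarking.measure_forall_notMem {q : E → ℝ} {M : ℕ → Ω → Bool}
    (hN : Measurable N) (hX : ∀ i, Measurable (X i))
    (h : IsIndependentMarking μ N X q M) (hq : Measurable q)
    (h01 : ∀ x, q x ∈ Set.Icc (0 : ℝ) 1) {S : Set E} (hS : MeasurableSet S) :
    μ {ω | ∀ i < N ω, M i ω = true → X i ω ∉ S} =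
      ∫⁻ ω, ENNReal.ofReal (∏ i ∈ Finset.range (N ω), (1 - S.indicator q (X i ω))) ∂μ := by
  classical
  have hNn : ∀ n, MeasurableSet {ω | N ω = n} := fun n => hN (measurableSet_singleton n)
  have hdisj : Pairwise (Function.onFun Disjoint fun n => {ω | N ω = n}) := by
    intro m n hmn
    exact Set.disjoint_left.mpr fun ω h1 h2 => hmn (h1.symm.trans h2)
  have hU : ⋃ n, {ω | N ω = n} = Set.univ := by ext ω; simp
  -- On the slice `N = n` the event splits according to the mark pattern `s`: points marked `true`
  -- must avoid `S`.
  have hpart : ∀ n : ℕ, μ ({ω | ∀ i < N ω, M i ω = true → X i ω ∉ S} ∩ {ω | N ω = n}) =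
      ∫⁻ ω in {ω | N ω = n},
        ENNReal.ofReal (∏ i ∈ Finset.range (N ω), (1 - S.indicator q (X i ω))) ∂μ := by
    intro n
    let B : (Fin n → Bool) → Set (Fin n → E) := fun s => {x | ∀ i, s i = true → x i ∉ S}
    have hB : ∀ s, MeasurableSet (B s) := fun s => by
      have : B s = ⋂ i, ⋂ _ : s i = true, (fun x : Fin n → E => x i) ⁻¹' Sᶜ := by
        ext x; simp [B]
      rw [this]
      exact MeasurableSet.iInter fun i => MeasurableSet.iInter fun _ =>
        measurable_pi_apply i hS.compl
    let T : (Fin n → Bool) → Set Ω := fun s =>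
      {ω | N ω = n ∧ (fun i : Fin n => X i ω) ∈ B s ∧ ∀ i : Fin n, M i ω = s i}
    have hXn : Measurable fun ω => fun i : Fin n => X i ω := measurable_pi_lambda _ fun i => hX i
    have hNB : ∀ s, MeasurableSet {ω | N ω = n ∧ (fun i : Fin n => X i ω) ∈ B s} := fun s =>
      (hNn n).inter (hXn (hB s))
    have hT : ∀ s, MeasurableSet (T s) := fun s => by
      have : T s = {ω | N ω = n} ∩ ((fun ω => fun i : Fin n => X i ω) ⁻¹' (B s) ∩
          ⋂ i : Fin n, M i ⁻¹' {s i}) := by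
        ext ω; simp [T]
      rw [this]
      exact (hNn n).inter ((hXn (hB s)).inter (MeasurableSet.iInter fun i =>
        h.measurable_mark i (measurableSet_singleton _)))
    have hunion : {ω | ∀ i < N ω, M i ω = true → X i ω ∉ S} ∩ {ω | N ω = n} = ⋃ s, T s := by
      ext ω
      simp only [Set.mem_inter_iff, Set.mem_ofPred_eq, Set.mem_iUnion, T, B]
      constructor
      · rintro ⟨h1, h2⟩
        exact ⟨fun i => M i ω, h2, fun i hi => h1 i (h2 ▸ i.2) hi, fun i => rfl⟩
      · rintro ⟨s, h1, h2, h3⟩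
        refine ⟨fun i hi hM => h2 ⟨i, h1 ▸ hi⟩ ?_, h1⟩
        rw [← h3]; exact hM
    have hTd : Pairwise (Function.onFun Disjoint T) := by
      intro s t hst
      refine Set.disjoint_left.mpr fun ω h1 h2 => hst (funext fun i => ?_)
      rw [← h1.2.2 i, h2.2.2 i]
    rw [hunion, measure_iUnion hTd hT, tsum_fintype]
    simp_rw [T, h.joint_law n _ _ (hB _)]
    -- Replacing `q` by `Sᶜ.indicator q` moves the constraint on positions into the integrand, one
    -- factor per point, so that the sum over patterns can factor.
    let w : Fin n → Bool → Ω → ℝ≥0∞ := fun i b ω =>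
      ENNReal.ofReal (if b = true then Sᶜ.indicator q (X i ω) else 1 - q (X i ω))
    have hw : ∀ i b, Measurable (w i b) := fun i b => by
      refine ENNReal.measurable_ofReal.comp ?_
      cases b
      · exact (hq.comp (hX i)).const_sub 1
      · exact (hq.indicator hS.compl).comp (hX i)
    have hterm : ∀ s : Fin n → Bool,
        ∫⁻ ω in {ω | N ω = n ∧ (fun i : Fin n => X i ω) ∈ B s},
          ∏ i : Fin n, ENNReal.ofReal (if s i = true then q (X i ω) else 1 - q (X i ω)) ∂μ =
        ∫⁻ ω in {ω | N ω = n}, ∏ i : Fin n, w i (s i) ω ∂μ := by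
      intro s
      rw [← lintegral_indicator (hNB s), ← lintegral_indicator (hNn n)]
      refine lintegral_congr fun ω => ?_
      by_cases h1 : N ω = n
      · by_cases h2 : (fun i : Fin n => X i ω) ∈ B s
        · rw [Set.indicator_of_mem
            (show ω ∈ {ω | N ω = n ∧ (fun i : Fin n => X i ω) ∈ B s} from ⟨h1, h2⟩),
            Set.indicator_of_mem (show ω ∈ {ω | N ω = n} from h1)]
          refine Finset.prod_congr rfl fun i _ => ?_
          by_cases hs : s i = true
          · simp [w, hs, Set.indicator_of_mem (show X i ω ∈ Sᶜ from h2 i hs)]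
          · simp [w, hs]
        · rw [Set.indicator_of_notMem (fun hh => h2 hh.2),
            Set.indicator_of_mem (show ω ∈ {ω | N ω = n} from h1)]
          simp only [B, Set.mem_ofPred_eq, not_forall, not_not] at h2
          obtain ⟨i, hi, hiS⟩ := h2
          refine (Finset.prod_eq_zero (Finset.mem_univ i) ?_).symm
          simp [w, hi, hiS]
      · rw [Set.indicator_of_notMem (fun hh => h1 hh.1),
          Set.indicator_of_notMem (show ω ∉ {ω | N ω = n} from h1)]
    simp_rw [hterm]
    rw [← lintegral_finsetSum _ fun s _ => Finset.measurable_fun_prod _ fun i _ => hw i (s i)]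
    refine setLIntegral_congr_fun (hNn n) fun ω hω => ?_
    have hω' : N ω = n := hω
    rw [hω', Finset.prod_range, ENNReal.ofReal_prod_of_nonneg]
    -- A sum over patterns of products is a product of two-term sums, each equal to `1 - S.indicator
    -- q`.
    · rw [← Fintype.piFinset_univ, ← Finset.prod_univ_sum (fun _ => Finset.univ) (fun i b => w i b ω)]
      refine Finset.prod_congr rfl fun i _ => ?_
      have hb := h01 (X i ω)
      rw [Fintype.sum_bool]
      simp only [w, if_true, Bool.false_eq_true, if_false]
      by_cases hiS : X i ω ∈ S
      · simp [hiS]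
      · rw [← ENNReal.ofReal_add]
        · simp [hiS]
        · simp [hiS, hb.1]
        · linarith [hb.2]
    · intro i _
      by_cases hiS : X i ω ∈ S
      · simpa [hiS] using (h01 _).2
      · simp [hiS]
  rw [← setLIntegral_univ (μ := μ), ← hU, lintegral_iUnion hNn hdisj]
  simp_rw [← hpart]
  conv_lhs => rw [← Set.inter_univ {ω | ∀ i < N ω, M i ω = true → X i ω ∉ S}, ← hU,
    Set.inter_iUnion]
  rw [measure_iUnion]
  · intro m n hmn
    exact (hdisj hmn).mono Set.inter_subset_right Set.inter_subset_right
  · exact fun n => (measurableSet_forall_notMem hN hX h.measurable_mark hS).inter (hNn n)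

/-- The void probabilities of an independent thinning of a Poisson point process. -/
theorem IsPoissonProcess.measure_forall_notMem [IsProbabilityMeasure μ] [IsFiniteMeasure Λ]
    (h : IsPoissonProcess μ N X Λ) {q : E → ℝ} {M : ℕ → Ω → Bool}
    (hM : IsIndependentMarking μ N X q M) (hq : Measurable q)
    (h01 : ∀ x, q x ∈ Set.Icc (0 : ℝ) 1) {S : Set E} (hS : MeasurableSet S) :
    μ {ω | ∀ i < N ω, M i ω = true → X i ω ∉ S} =
      ENNReal.ofReal (Real.exp (-∫ x in S, q x ∂Λ)) := by
  have hmem : ∀ x, 1 - S.indicator q x ∈ Set.Icc (0 : ℝ) 1 := fun x => by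
    by_cases hx : x ∈ S
    · have := h01 x
      simp only [hx, Set.indicator_of_mem]
      constructor <;> linarith [this.1, this.2]
    · simp [hx]
  have hmeas : Measurable fun x => 1 - S.indicator q x := (hq.indicator hS).const_sub 1
  rw [hM.measure_forall_notMem h.measurable_number h.measurable_point hq h01 hS,
    ← ofReal_integral_eq_lintegral_ofReal, h.integral_prod hmeas hmem]
  · congr 2
    rw [← integral_indicator hS, ← integral_neg]
    congr 1 with x
    ring
  · refine Integrable.of_bound (C := 1) (measurable_prod_range h.measurable_number
      fun i => hmeas.comp (h.measurable_point i)).aestronglyMeasurable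
      (Filter.Eventually.of_forall fun ω => ?_)
    rw [Real.norm_of_nonneg (Finset.prod_nonneg fun i _ => (hmem _).1)]
    exact Finset.prod_le_one (fun i _ => (hmem _).1) fun i _ => (hmem _).2
  · exact Filter.Eventually.of_forall fun ω => Finset.prod_nonneg fun i _ => (hmem _).1

end

/-! ### Intersection of the two circles and the angle `theta` -/

theorem heron_pos {R l r : ℝ} (hrR : r ≤ R) (h1 : R - r < l) (h2 : l < R + r) :
    0 < (r + R + l) * (r + R - l) * (r - R + l) * (-r + R + l) := by
  have ha : 0 < r + R + l := by linarith
  have hb : 0 < r + R - l := by linarith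
  have hc : 0 < r - R + l := by linarith
  have hd : 0 < -r + R + l := by linarith
  positivity

theorem delta_pos {R l r : ℝ} (hrR : r ≤ R) (h1 : R - r < l) (h2 : l < R + r) :
    0 < delta R l r :=
  div_pos (Real.sqrt_pos.mpr (heron_pos hrR h1 h2)) (by norm_num)

theorem sq_delta {R l r : ℝ} (hrR : r ≤ R) (h1 : R - r < l) (h2 : l < R + r) :
    16 * delta R l r ^ 2 = (r + R + l) * (r + R - l) * (r - R + l) * (-r + R + l) := by
  rw [delta, div_pow, Real.sq_sqrt (heron_pos hrR h1 h2).le]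
  ring

theorem m₂_eq_neg (R l r : ℝ) : m₂ R l r = -m₁ R l r := by
  rw [m₂, m₁, x₂, x₁, div_neg]

/-- The cosine of the angle at the user between the outward direction and an intersection point of
the two circles, by the law of cosines. -/
def cosAngle (R l r : ℝ) : ℝ := (R ^ 2 - r ^ 2 - l ^ 2) / (2 * l * r)

/-- Subtracting the two circle equations leaves a linear equation for the ordinate; the abscissa is
then known up to sign, by Heron's formula. -/
theorem sphere_inter_sphere {R l r : ℝ} (hr : 0 < r) (hrR : r ≤ R) (h1 : R - r < l)
    (h2 : l < R + r) :
    Metric.sphere (0 : Plane) R ∩ Metric.sphere (!₂[0, r] : Plane) l =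
      {!₂[x₁ R l r, y₁₂ R l r], !₂[x₂ R l r, y₁₂ R l r]} := by
  have hl : 0 < l := by linarith
  have hR : 0 < R := by linarith
  have hd := sq_delta hrR h1 h2
  have hx : x₁ R l r ^ 2 + y₁₂ R l r ^ 2 = R ^ 2 := by
    have : delta R l r ^ 2 = (r + R + l) * (r + R - l) * (r - R + l) * (-r + R + l) / 16 := by
      linarith
    rw [x₁, y₁₂, div_pow, mul_pow, this]
    field_simp
    ring
  have hy : 2 * r * y₁₂ R l r = r ^ 2 + R ^ 2 - l ^ 2 := by
    rw [y₁₂]; field_simp; ring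
  have hx2 : x₂ R l r = -x₁ R l r := rfl
  have hS : ∀ p : Plane, p ∈ Metric.sphere (0 : Plane) R ∩ Metric.sphere (!₂[0, r] : Plane) l ↔
      p 0 ^ 2 + p 1 ^ 2 = R ^ 2 ∧ p 0 ^ 2 + (p 1 - r) ^ 2 = l ^ 2 := by
    intro p
    rw [Set.mem_inter_iff, mem_sphere_zero_iff_norm, mem_sphere_iff_norm,
      EuclideanSpace.norm_eq, EuclideanSpace.norm_eq, Real.sqrt_eq_iff_eq_sq (by positivity) hR.le,
      Real.sqrt_eq_iff_eq_sq (by positivity) hl.le]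
    simp [Fin.sum_univ_two]
  have hext : ∀ (p : Plane) (a b : ℝ), p = !₂[a, b] ↔ p 0 = a ∧ p 1 = b := by
    intro p a b
    constructor
    · rintro rfl; simp
    · rintro ⟨h1, h2⟩
      ext i
      fin_cases i
      · simpa using h1
      · simpa using h2
  ext p
  rw [hS, Set.mem_insert_iff, Set.mem_singleton_iff, hext, hext, hx2]
  constructor
  · rintro ⟨e1, e2⟩
    have hp1 : p 1 = y₁₂ R l r := by
      have : 2 * r * p 1 = 2 * r * y₁₂ R l r := by rw [hy]; linarith
      exact mul_left_cancel₀ (by positivity) this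
    have : p 0 ^ 2 = x₁ R l r ^ 2 := by rw [hp1] at e1; linarith
    rcases sq_eq_sq_iff_eq_or_eq_neg.mp this with h | h
    · exact Or.inl ⟨h, hp1⟩
    · exact Or.inr ⟨h, hp1⟩
  · rintro (⟨e1, e2⟩ | ⟨e1, e2⟩) <;> rw [e1, e2] <;> constructor <;> nlinarith

theorem theta_eq {R l r : ℝ} (h2 : l < R + r) :
    theta R l r = Real.pi + 2 * Real.arctan (m₁ R l r) := by
  rw [theta, if_pos h2, m₂_eq_neg, Real.arctan_neg]; ring

theorem theta_mem_Ioo {R l r : ℝ} (h2 : l < R + r) :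
    theta R l r ∈ Set.Ioo 0 (2 * Real.pi) := by
  rw [theta_eq h2]
  constructor <;>
    linarith [Real.neg_pi_div_two_lt_arctan (m₁ R l r), Real.arctan_lt_pi_div_two (m₁ R l r)]

/-- Double-angle formula with `m₂ = -m₁`. No side condition is needed: where the denominator
vanishes, both sides are 0 by convention. -/
theorem tan_theta {R l r : ℝ} (h2 : l < R + r) :
    Real.tan (theta R l r) = (m₁ R l r - m₂ R l r) / (1 + m₁ R l r * m₂ R l r) := by
  rw [theta_eq h2, add_comm, Real.tan_add_pi, Real.tan_two_mul, Real.tan_arctan, m₂_eq_neg]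
  ring_nf

/-- By Heron's formula `2δ / (l r)` is the sine belonging to `cosAngle`, so `m₁` is cosine over
sine, that is, the tangent of `arcsin (cosAngle)`. -/
theorem arctan_m₁ {R l r : ℝ} (hr : 0 < r) (hrR : r ≤ R) (h1 : R - r < l) (h2 : l < R + r) :
    Real.arctan (m₁ R l r) = Real.arcsin (cosAngle R l r) := by
  have hl : 0 < l := by linarith
  have hd := sq_delta hrR h1 h2
  have hdp := delta_pos hrR h1 h2
  have hs : 1 - cosAngle R l r ^ 2 = (2 * delta R l r / (l * r)) ^ 2 := by
    rw [cosAngle, div_pow, div_pow]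
    field_simp
    linear_combination (-1) * hd
  have hsp : 0 < 2 * delta R l r / (l * r) := by positivity
  have habs : cosAngle R l r ^ 2 < 1 := by nlinarith [pow_pos hsp 2]
  have hmem : cosAngle R l r ∈ Set.Ioo (-1 : ℝ) 1 := abs_lt.mp ((sq_lt_one_iff_abs_lt_one _).mp habs)
  rw [Real.arcsin_eq_arctan hmem, hs, Real.sqrt_sq hsp.le]
  congr 1
  rw [m₁, y₁₂, x₁, cosAngle]
  field_simp
  ring

/-- For `l ≥ R + r` one has `cosAngle ≤ -1`; `arccos` is then `π`, in agreement with the zero branch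
of `theta`. -/
theorem theta_eq_arccos {R l r : ℝ} (hr : 0 < r) (hrR : r ≤ R) (h1 : R - r < l) :
    theta R l r = 2 * Real.pi - 2 * Real.arccos (cosAngle R l r) := by
  have hl : 0 < l := by linarith
  rcases lt_or_ge l (R + r) with h2 | h2
  · rw [theta_eq h2, arctan_m₁ hr hrR h1 h2, Real.arccos]; ring
  · rw [theta, if_neg (not_lt.mpr h2), Real.arccos_of_le_neg_one, sub_self]
    rw [cosAngle, div_le_iff₀ (by positivity)]
    nlinarith

theorem measurable_C (R r : ℝ) : Measurable fun l => C R l r := by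
  have hm : Measurable fun l => m₁ R l r := by
    unfold m₁ y₁₂ x₁ delta; fun_prop
  have hm2 : Measurable fun l => m₂ R l r := by
    unfold m₂ y₁₂ x₂ delta; fun_prop
  have : Measurable fun l => theta R l r := by
    unfold theta
    exact Measurable.ite (measurableSet_lt measurable_id measurable_const)
      (((Real.measurable_arctan.comp hm).const_add _).sub (Real.measurable_arctan.comp hm2))
      measurable_const
  exact this.mul measurable_id

/-! ### The length of the arc in the disk -/

theorem cos_le_iff_arccos_le_abs {c φ : ℝ} (h1 : -1 ≤ c) (h2 : c ≤ 1) (hφ : |φ| ≤ Real.pi) :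
    Real.cos φ ≤ c ↔ Real.arccos c ≤ |φ| := by
  conv_lhs => rw [← Real.cos_abs, ← Real.cos_arccos h1 h2]
  exact Real.strictAntiOn_cos.le_iff_ge ⟨abs_nonneg _, hφ⟩
    ⟨Real.arccos_nonneg _, Real.arccos_le_pi _⟩

/-- The excluded angles are those with `|φ| < arccos c`. Because `arccos` is constant outside `[-1,
1]`, the formula holds for every real `c`. -/
theorem volume_real_cos_le (c : ℝ) :
    volume.real {φ : ℝ | φ ∈ Set.Ioc (-Real.pi) Real.pi ∧ Real.cos φ ≤ c} =
      2 * Real.pi - 2 * Real.arccos c := by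
  have hpi := Real.pi_pos
  rcases lt_or_ge c (-1) with h1 | h1
  · have : {φ : ℝ | φ ∈ Set.Ioc (-Real.pi) Real.pi ∧ Real.cos φ ≤ c} = ∅ := by
      ext φ
      simp only [Set.mem_ofPred_eq, Set.mem_empty_iff_false, iff_false, not_and, not_le]
      intro _
      linarith [Real.neg_one_le_cos φ]
    rw [this, Real.arccos_of_le_neg_one h1.le]
    simp
  rcases le_or_gt c 1 with h2 | h2
  · have hset : {φ : ℝ | φ ∈ Set.Ioc (-Real.pi) Real.pi ∧ Real.cos φ ≤ c} =
        Set.Ioc (-Real.pi) Real.pi \ Set.Ioo (-Real.arccos c) (Real.arccos c) := by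
      ext φ
      simp only [Set.mem_ofPred_eq, Set.mem_sdiff]
      refine and_congr_right fun hφ => ?_
      rw [cos_le_iff_arccos_le_abs h1 h2 (abs_le.mpr ⟨hφ.1.le, hφ.2⟩), Set.mem_Ioo, ← abs_lt,
        not_lt]
    rw [hset, measureReal_sdiff _ measurableSet_Ioo (by simp), Real.volume_real_Ioc_of_le (by linarith),
      Real.volume_real_Ioo_of_le (by linarith [Real.arccos_nonneg c])]
    · ring
    · intro φ hφ
      have := Real.arccos_le_pi c
      exact ⟨by linarith [hφ.1], by linarith [hφ.2]⟩
  · have : {φ : ℝ | φ ∈ Set.Ioc (-Real.pi) Real.pi ∧ Real.cos φ ≤ c} =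
        Set.Ioc (-Real.pi) Real.pi := by
      ext φ
      simp only [Set.mem_ofPred_eq, and_iff_left_iff_imp]
      intro _
      linarith [Real.cos_le_one φ]
    rw [this, Real.arccos_of_one_le h2.le, Real.volume_real_Ioc_of_le (by linarith)]
    ring

/-- A rotation does not change the measure, since the integral of a periodic function over a period
does not depend on where it starts. -/
theorem volume_real_cos_sub_le (c α : ℝ) :
    volume.real {φ : ℝ | φ ∈ Set.Ioc (-Real.pi) Real.pi ∧ Real.cos (φ - α) ≤ c} =
      2 * Real.pi - 2 * Real.arccos c := by
  have hpi := Real.pi_pos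
  have key : ∀ β, volume.real {φ : ℝ | φ ∈ Set.Ioc (-Real.pi) Real.pi ∧ Real.cos (φ - β) ≤ c} =
      ∫ φ in (-Real.pi)..Real.pi, {φ | Real.cos φ ≤ c}.indicator (fun _ => (1 : ℝ)) (φ - β) := by
    intro β
    have hms : MeasurableSet {φ | Real.cos (φ - β) ≤ c} :=
      measurableSet_le (by fun_prop) measurable_const
    have h : ∀ φ, {φ | Real.cos φ ≤ c}.indicator (fun _ => (1 : ℝ)) (φ - β) =
        {φ | Real.cos (φ - β) ≤ c}.indicator (fun _ => (1 : ℝ)) φ := fun φ => rfl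
    simp_rw [h]
    rw [intervalIntegral.integral_of_le (by linarith), setIntegral_indicator hms]
    simp
    rfl
  have hper : Function.Periodic ({φ | Real.cos φ ≤ c}.indicator (fun _ => (1 : ℝ)))
      (2 * Real.pi) := by
    intro φ
    simp [Set.indicator_apply, Real.cos_add_two_pi]
  rw [key, intervalIntegral.integral_comp_sub_right,
    show Real.pi - α = (-Real.pi - α) + 2 * Real.pi by ring,
    hper.intervalIntegral_add_eq (-Real.pi - α) (-Real.pi), ← volume_real_cos_le]
  have h0 := key 0
  simp only [sub_zero] at h0
  rw [h0]
  ring_nf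

theorem exists_eq_polar (u : Plane) :
    ∃ α : ℝ, u 0 = ‖u‖ * Real.cos α ∧ u 1 = ‖u‖ * Real.sin α := by
  have hn : ‖(⟨u 0, u 1⟩ : ℂ)‖ = ‖u‖ := by
    rw [Complex.norm_eq_sqrt_sq_add_sq, EuclideanSpace.norm_eq]
    simp [Fin.sum_univ_two]
  refine ⟨Complex.arg ⟨u 0, u 1⟩, ?_, ?_⟩
  · rw [← hn, Complex.norm_mul_cos_arg]
  · rw [← hn, Complex.norm_mul_sin_arg]

theorem norm_smul_cos_sin (l φ : ℝ) :
    ‖l • (!₂[Real.cos φ, Real.sin φ] : Plane)‖ = |l| := by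
  rw [norm_smul, EuclideanSpace.norm_eq]
  simp [Fin.sum_univ_two]

theorem sq_norm_add_smul (u : Plane) (l φ : ℝ) :
    ‖u + l • (!₂[Real.cos φ, Real.sin φ] : Plane)‖ ^ 2 =
      ‖u‖ ^ 2 + l ^ 2 + 2 * l * (u 0 * Real.cos φ + u 1 * Real.sin φ) := by
  rw [EuclideanSpace.real_norm_sq_eq, EuclideanSpace.real_norm_sq_eq]
  simp [Fin.sum_univ_two]
  linear_combination l ^ 2 * Real.sin_sq_add_cos_sq φ

/-- With `α` the polar angle of `u`, the law of cosines turns membership in the disk into `cos (φ -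
α) ≤ cosAngle`. -/
theorem arcLengthInDisk_of_pos {R l : ℝ} {u : Plane} (hR : 0 < R) (hl : 0 < l) (hu : 0 < ‖u‖) :
    arcLengthInDisk R u l = l * (2 * Real.pi - 2 * Real.arccos (cosAngle R l ‖u‖)) := by
  obtain ⟨α, h0, h1⟩ := exists_eq_polar u
  rw [arcLengthInDisk, ← volume_real_cos_sub_le _ α]
  congr 3
  ext φ
  refine and_congr_right fun _ => ?_
  rw [mem_closedBall_zero_iff, ← sq_le_sq₀ (norm_nonneg _) hR.le, sq_norm_add_smul, cosAngle,
    le_div_iff₀ (by positivity), Real.cos_sub, h0, h1]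
  constructor <;> intro h <;> nlinarith

theorem arcLengthInDisk_of_le {R l : ℝ} {u : Plane} (hl : 0 ≤ l) (h : l ≤ R - ‖u‖) :
    arcLengthInDisk R u l = 2 * Real.pi * l := by
  have hpi := Real.pi_pos
  have : {φ : ℝ | φ ∈ Set.Ioc (-Real.pi) Real.pi ∧
      u + l • (!₂[Real.cos φ, Real.sin φ] : Plane) ∈ Metric.closedBall (0 : Plane) R} =
      Set.Ioc (-Real.pi) Real.pi := by
    ext φ
    simp only [Set.mem_ofPred_eq, and_iff_left_iff_imp]
    intro _
    rw [mem_closedBall_zero_iff]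
    refine (norm_add_le _ _).trans ?_
    rw [norm_smul_cos_sin, abs_of_nonneg hl]
    linarith
  rw [arcLengthInDisk, this, Real.volume_real_Ioc_of_le (by linarith)]
  ring

theorem arcLengthInDisk_of_lt {R l : ℝ} {u : Plane} (hR : 0 < R) (hu : ‖u‖ ≤ R)
    (h : R - ‖u‖ < l) : arcLengthInDisk R u l = C R l ‖u‖ := by
  have hl : 0 < l := by linarith
  -- At the origin `cosAngle` divides by zero, so this case is separate: the circle misses the disk
  -- and `theta` is in its zero branch.
  rcases (norm_nonneg u).eq_or_lt with h0 | h0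
  · have hu0 : u = 0 := norm_eq_zero.mp h0.symm
    subst hu0
    simp only [norm_zero, sub_zero] at h ⊢
    have : {φ : ℝ | φ ∈ Set.Ioc (-Real.pi) Real.pi ∧
        (0 : Plane) + l • (!₂[Real.cos φ, Real.sin φ] : Plane) ∈
          Metric.closedBall (0 : Plane) R} = ∅ := by
      ext φ
      simp only [Set.mem_ofPred_eq, Set.mem_empty_iff_false, iff_false, not_and]
      intro _
      rw [mem_closedBall_zero_iff, zero_add, norm_smul_cos_sin, abs_of_pos hl]
      exact not_le.mpr h
    rw [arcLengthInDisk, this, C, theta, if_neg (by simpa using h.le)]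
    simp
  · rw [arcLengthInDisk_of_pos hR hl h0, C, theta_eq_arccos h0 hu h, mul_comm]

theorem arcLengthInDisk_nonneg (R : ℝ) (u : Plane) {l : ℝ} (hl : 0 ≤ l) :
    0 ≤ arcLengthInDisk R u l := mul_nonneg hl measureReal_nonneg

theorem arcLengthInDisk_le (R : ℝ) (u : Plane) {l : ℝ} (hl : 0 ≤ l) :
    arcLengthInDisk R u l ≤ 2 * Real.pi * l := by
  have hpi := Real.pi_pos
  rw [arcLengthInDisk, mul_comm]
  refine mul_le_mul_of_nonneg_right ?_ hl
  have : volume.real (Set.Ioc (-Real.pi) Real.pi) = 2 * Real.pi := by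
    rw [Real.volume_real_Ioc_of_le (by linarith)]; ring
  rw [← this]
  exact measureReal_mono (fun φ h => h.1) (by simp)

/-! ### Radial integrals over the intersection of two disks -/

theorem measurePreserving_toPlane :
    MeasurePreserving (fun p : ℝ × ℝ => (!₂[p.1, p.2] : Plane)) := by
  have h := (PiLp.volume_preserving_toLp (Fin 2)).comp (volume_preserving_finTwoArrow ℝ).symm
  exact h

/-- Integration over the plane in polar coordinates around `u`. -/
theorem lintegral_plane_polar (u : Plane) {F : Plane → ℝ≥0∞} (hF : Measurable F) :
    ∫⁻ x, F x = ∫⁻ v in Set.Ioi (0 : ℝ), ENNReal.ofReal v *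
      ∫⁻ φ in Set.Ioc (-Real.pi) Real.pi, F (u + v • !₂[Real.cos φ, Real.sin φ]) := by
  have hpol : Measurable fun p : ℝ × ℝ =>
      u + p.1 • (!₂[Real.cos p.2, Real.sin p.2] : Plane) := by
    have h : Measurable fun p : ℝ × ℝ => (!₂[Real.cos p.2, Real.sin p.2] : Plane) :=
      measurePreserving_toPlane.measurable.comp
        (f := fun p : ℝ × ℝ => (Real.cos p.2, Real.sin p.2)) (by fun_prop)
    exact (measurable_fst.smul h).const_add u
  rw [← lintegral_add_left_eq_self F u,
    ← measurePreserving_toPlane.lintegral_comp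
      (show Measurable fun x => F (u + x) from hF.comp (measurable_const_add u)),
    ← lintegral_comp_polarCoord_symm]
  have ht : polarCoord.target = Set.Ioi (0 : ℝ) ×ˢ Set.Ioo (-Real.pi) Real.pi := rfl
  rw [ht, Measure.volume_eq_prod, ← Measure.prod_restrict]
  have hpt : ∀ p : ℝ × ℝ, ENNReal.ofReal p.1 •
      F (u + !₂[(polarCoord.symm p).1, (polarCoord.symm p).2]) =
      ENNReal.ofReal p.1 * F (u + p.1 • (!₂[Real.cos p.2, Real.sin p.2] : Plane)) := by
    intro p
    rw [smul_eq_mul]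
    congr 3
    ext i
    fin_cases i <;> simp [polarCoord]
  simp_rw [hpt]
  rw [lintegral_prod]
  · refine lintegral_congr fun v => ?_
    dsimp only
    rw [lintegral_const_mul _ (show Measurable fun φ => F (u + v • !₂[Real.cos φ, Real.sin φ]) from
      hF.comp (hpol.comp (measurable_const.prodMk measurable_id))),
      restrict_Ioo_eq_restrict_Ioc]
  · exact ((ENNReal.measurable_ofReal.comp measurable_fst).mul (hF.comp hpol)).aemeasurable

/-- The integral of a radial function around `u` over the intersection of two disks. -/
theorem lintegral_disk_radial (R t : ℝ) (u : Plane) {q : ℝ → ℝ} (hq : Measurable q) :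
    ∫⁻ x in Metric.closedBall u t, ENNReal.ofReal (q (dist u x))
        ∂(volume.restrict (Metric.closedBall (0 : Plane) R)) =
      ∫⁻ v in Set.Ioc 0 t, ENNReal.ofReal (arcLengthInDisk R u v * q v) := by
  rw [Measure.restrict_restrict Metric.isClosed_closedBall.measurableSet,
    ← lintegral_indicator (Metric.isClosed_closedBall.measurableSet.inter
      Metric.isClosed_closedBall.measurableSet), lintegral_plane_polar u,
    show Set.Ioc 0 t = Set.Iic t ∩ Set.Ioi 0 from (Set.Iic_inter_Ioi).symm,
    ← Measure.restrict_restrict measurableSet_Iic, ← lintegral_indicator measurableSet_Iic]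
  · refine setLIntegral_congr_fun measurableSet_Ioi fun v hv => ?_
    have hv0 : 0 < v := hv
    -- At fixed radius the integrand is a constant times the indicator of the admissible angles,
    -- whose measure times `v` is the arc length.
    have hd : ∀ φ : ℝ, dist u (u + v • (!₂[Real.cos φ, Real.sin φ] : Plane)) = v := fun φ => by
      rw [dist_eq_norm', add_sub_cancel_left, norm_smul_cos_sin, abs_of_pos hv0]
    let A : Set ℝ := {φ | u + v • (!₂[Real.cos φ, Real.sin φ] : Plane) ∈
      Metric.closedBall (0 : Plane) R}
    have hA : MeasurableSet A := by
      have hc : Continuous fun φ : ℝ => u + v • (!₂[Real.cos φ, Real.sin φ] : Plane) := by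
        fun_prop
      exact (Metric.isClosed_closedBall.preimage hc).measurableSet
    by_cases hvt : v ≤ t
    · have hin : ∀ φ : ℝ, (Metric.closedBall u t ∩ Metric.closedBall 0 R).indicator
          (fun x => ENNReal.ofReal (q (dist u x))) (u + v • !₂[Real.cos φ, Real.sin φ]) =
          A.indicator (fun _ => ENNReal.ofReal (q v)) φ := by
        intro φ
        have hm : u + v • (!₂[Real.cos φ, Real.sin φ] : Plane) ∈ Metric.closedBall u t := by
          rw [Metric.mem_closedBall, dist_comm, hd]; exact hvt
        by_cases hφ : φ ∈ A
        · rw [Set.indicator_of_mem hφ, Set.indicator_of_mem (Set.mem_inter hm hφ), hd]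
        · rw [Set.indicator_of_notMem hφ, Set.indicator_of_notMem fun h => hφ h.2]
      simp_rw [hin]
      rw [Set.indicator_of_mem (show v ∈ Set.Iic t from hvt), lintegral_indicator hA,
        setLIntegral_const, Measure.restrict_apply hA,
        ENNReal.ofReal_mul (arcLengthInDisk_nonneg R u hv0.le), arcLengthInDisk,
        ENNReal.ofReal_mul hv0.le, ofReal_measureReal (measure_ne_top_of_subset (fun φ h => h.1)
          (show volume (Set.Ioc (-Real.pi) Real.pi) ≠ ∞ by simp)),
        show A ∩ Set.Ioc (-Real.pi) Real.pi = {φ | φ ∈ Set.Ioc (-Real.pi) Real.pi ∧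
          u + v • (!₂[Real.cos φ, Real.sin φ] : Plane) ∈ Metric.closedBall (0 : Plane) R} from
          Set.inter_comm _ _]
      ring
    · have hin : ∀ φ : ℝ, (Metric.closedBall u t ∩ Metric.closedBall 0 R).indicator
          (fun x => ENNReal.ofReal (q (dist u x))) (u + v • !₂[Real.cos φ, Real.sin φ]) = 0 := by
        intro φ
        refine Set.indicator_of_notMem (fun h => hvt ?_) _
        have := h.1
        rwa [Metric.mem_closedBall, dist_comm, hd] at this
      simp_rw [hin]
      rw [Set.indicator_of_notMem (show v ∉ Set.Iic t from hvt)]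
      simp
  · exact (ENNReal.measurable_ofReal.comp (hq.comp (by fun_prop))).indicator
      (Metric.isClosed_closedBall.measurableSet.inter Metric.isClosed_closedBall.measurableSet)

/-! ### Exponential of an absolutely continuous primitive -/

theorem absolutelyContinuousOnInterval_of_dist_le {f g : ℝ → ℝ} {a b : ℝ}
    (hf : AbsolutelyContinuousOnInterval f a b)
    (h : ∀ x ∈ Set.uIcc a b, ∀ y ∈ Set.uIcc a b, dist (g x) (g y) ≤ dist (f x) (f y)) :
    AbsolutelyContinuousOnInterval g a b := by
  rw [absolutelyContinuousOnInterval_iff] at hf ⊢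
  intro ε hε
  obtain ⟨δ, hδ, H⟩ := hf ε hε
  refine ⟨δ, hδ, fun I hI hs => lt_of_le_of_lt (Finset.sum_le_sum fun i hi => ?_) (H I hI hs)⟩
  exact h _ (hI.1 i hi).1 _ (hI.1 i hi).2

/-- `exp (-x)` is 1-Lipschitz on `[0, ∞)`, by `1 + x ≤ exp x`; hence absolute continuity passes from
`∫ k` to `exp (-∫ k)`. -/
theorem dist_exp_neg_le {a b : ℝ} (ha : 0 ≤ a) (hb : 0 ≤ b) :
    dist (Real.exp (-a)) (Real.exp (-b)) ≤ dist a b := by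
  wlog hab : a ≤ b generalizing a b
  · rw [dist_comm, dist_comm a]
    exact this hb ha (le_of_not_ge hab)
  have h1 : Real.exp (-b) ≤ Real.exp (-a) := Real.exp_le_exp.mpr (by linarith)
  have h2 : Real.exp (-a) ≤ 1 := Real.exp_le_one_iff.mpr (by linarith)
  have h3 : Real.exp (-b) = Real.exp (-a) * Real.exp (a - b) := by
    rw [← Real.exp_add]; ring_nf
  have h4 := Real.add_one_le_exp (a - b)
  rw [Real.dist_eq, Real.dist_eq, abs_of_nonneg (by linarith), abs_sub_comm,
    abs_of_nonneg (by linarith : (0 : ℝ) ≤ b - a), h3]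
  nlinarith [Real.exp_pos (-a)]

/-- The fundamental theorem of calculus for `exp (-∫ k)` with `k ≥ 0` merely integrable. -/
theorem integral_mul_exp_neg_integral {k : ℝ → ℝ} {t : ℝ} (ht : 0 ≤ t)
    (hk : IntervalIntegrable k volume 0 t) (hk0 : ∀ v ∈ Set.Icc 0 t, 0 ≤ k v) :
    ∫ v in (0 : ℝ)..t, k v * Real.exp (-∫ w in (0 : ℝ)..v, k w) =
      1 - Real.exp (-∫ w in (0 : ℝ)..t, k w) := by
  have hac := hk.absolutelyContinuousOnInterval_intervalIntegral (c := 0) (by simp)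
  have hH0 : ∀ v ∈ Set.uIcc 0 t, 0 ≤ ∫ w in (0 : ℝ)..v, k w := fun v hv => by
    rw [Set.uIcc_of_le ht] at hv
    exact intervalIntegral.integral_nonneg hv.1 fun w hw => hk0 w ⟨hw.1, hw.2.trans hv.2⟩
  have hexp : AbsolutelyContinuousOnInterval
      (fun v => Real.exp (-∫ w in (0 : ℝ)..v, k w)) 0 t :=
    absolutelyContinuousOnInterval_of_dist_le hac fun x hx y hy =>
      dist_exp_neg_le (hH0 x hx) (hH0 y hy)
  have h := hexp.integral_deriv_eq_sub
  have hder : ∫ v in (0 : ℝ)..t, deriv (fun v => Real.exp (-∫ w in (0 : ℝ)..v, k w)) v =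
      ∫ v in (0 : ℝ)..t, -(k v * Real.exp (-∫ w in (0 : ℝ)..v, k w)) := by
    refine intervalIntegral.integral_congr_ae ?_
    filter_upwards [hk.ae_hasDerivAt_integral] with v hv hvt
    have := (hv (Set.uIoc_subset_uIcc hvt) 0 (by simp)).fun_neg.exp
    rw [this.deriv]
    ring
  rw [hder, intervalIntegral.integral_neg] at h
  simp only [intervalIntegral.integral_same, neg_zero, Real.exp_zero] at h
  linarith

/-! ### Intensity of the LOS distances, and `B_L` and `f_L` in terms of it -/

/-- The length of the part of the circle of radius `v` around the user that lies in the disk. -/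
def arcProfile (R r v : ℝ) : ℝ := if v ≤ R - r then 2 * Real.pi * v else C R v r

/-- The intensity of the distances to the line-of-sight base stations. -/
def losRate (lamb R : ℝ) (pB : ℝ → ℝ) (r v : ℝ) : ℝ := lamb * (arcProfile R r v * (1 - pB v))

theorem arcLengthInDisk_eq_arcProfile {R : ℝ} {u : Plane} (hR : 0 < R) (hu : ‖u‖ ≤ R) {v : ℝ}
    (hv : 0 ≤ v) : arcLengthInDisk R u v = arcProfile R ‖u‖ v := by
  rw [arcProfile]
  split_ifs with h
  · exact arcLengthInDisk_of_le hv h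
  · exact arcLengthInDisk_of_lt hR hu (not_le.mp h)

theorem measurable_losRate {pB : ℝ → ℝ} (hpB : Measurable pB) (lamb R r : ℝ) :
    Measurable (losRate lamb R pB r) := by
  have h : Measurable (arcProfile R r) :=
    Measurable.ite (measurableSet_le measurable_id measurable_const)
      (measurable_id.const_mul _) (measurable_C R r)
  exact (h.mul (hpB.const_sub 1)).const_mul lamb

section

variable {lamb R : ℝ} {pB : ℝ → ℝ} {u : Plane}

theorem losRate_mem_Icc (hlamb : 0 < lamb) (hR : 0 < R) (hu : ‖u‖ ≤ R)
    (hpB : IsBlockageProfile pB) {v : ℝ} (hv : 0 ≤ v) :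
    losRate lamb R pB ‖u‖ v ∈ Set.Icc 0 (lamb * (2 * Real.pi * v)) := by
  have h1 := arcLengthInDisk_nonneg R u hv
  have h2 := arcLengthInDisk_le R u hv
  rw [arcLengthInDisk_eq_arcProfile hR hu hv] at h1 h2
  obtain ⟨h3, h4⟩ := hpB.mem_Icc v hv
  refine ⟨mul_nonneg hlamb.le (mul_nonneg h1 (by linarith)),
    mul_le_mul_of_nonneg_left ?_ hlamb.le⟩
  nlinarith

theorem intervalIntegrable_losRate (hlamb : 0 < lamb) (hR : 0 < R) (hu : ‖u‖ ≤ R)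
    (hpB : IsBlockageProfile pB) {a b : ℝ} (ha : 0 ≤ a) (hb : 0 ≤ b) :
    IntervalIntegrable (losRate lamb R pB ‖u‖) volume a b := by
  have hdom : IntervalIntegrable (fun v => lamb * (2 * Real.pi * v)) volume a b :=
    Continuous.intervalIntegrable (by fun_prop) _ _
  refine hdom.mono_fun (measurable_losRate hpB.measurable _ _ _).aestronglyMeasurable ?_
  refine (ae_restrict_iff' measurableSet_uIoc).mpr (Filter.Eventually.of_forall fun v hv => ?_)
  have hv0 : 0 ≤ v := (le_min ha hb).trans hv.1.le
  obtain ⟨h1, h2⟩ := losRate_mem_Icc hlamb hR hu hpB hv0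
  exact (Real.norm_of_nonneg h1).trans_le (h2.trans (le_abs_self _))

theorem integral_losRate_of_le {r l : ℝ} (hl0 : 0 ≤ l) (hl : l ≤ R - r) :
    ∫ v in (0 : ℝ)..l, losRate lamb R pB r v =
      2 * Real.pi * lamb * ∫ v in (0 : ℝ)..l, v * (1 - pB v) := by
  rw [← intervalIntegral.integral_const_mul]
  refine intervalIntegral.integral_congr fun v hv => ?_
  rw [Set.uIcc_of_le hl0] at hv
  simp only [losRate, arcProfile, if_pos (hv.2.trans hl)]
  ring

theorem integral_losRate_of_ge (hlamb : 0 < lamb) (hR : 0 < R) (hu : ‖u‖ ≤ R)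
    (hpB : IsBlockageProfile pB) {l : ℝ} (hl : R - ‖u‖ ≤ l) :
    ∫ v in (0 : ℝ)..l, losRate lamb R pB ‖u‖ v =
      lamb * ((2 * Real.pi * ∫ v in (0 : ℝ)..(R - ‖u‖), v * (1 - pB v)) +
        ∫ v in (R - ‖u‖)..l, C R v ‖u‖ * (1 - pB v)) := by
  have h0 : 0 ≤ R - ‖u‖ := by linarith
  rw [← intervalIntegral.integral_add_adjacent_intervals
    (intervalIntegrable_losRate hlamb hR hu hpB le_rfl h0)
    (intervalIntegrable_losRate hlamb hR hu hpB h0 (h0.trans hl)),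
    integral_losRate_of_le h0 le_rfl, mul_add, ← intervalIntegral.integral_const_mul lamb]
  congr 1
  · ring
  -- The half-open interval omits `R - ‖u‖`, where `arcProfile` takes its other branch.
  · rw [intervalIntegral.integral_of_le hl, intervalIntegral.integral_of_le hl]
    refine setIntegral_congr_fun measurableSet_Ioc fun v hv => ?_
    simp only [losRate, arcProfile, if_neg (not_le.mpr hv.1)]

theorem B_L_eq (hlamb : 0 < lamb) (hR : 0 < R) (hu : ‖u‖ ≤ R)
    (hpB : IsBlockageProfile pB) {r₀ : ℝ} (hr₀ : 0 < r₀) :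
    B_L lamb R r₀ pB ‖u‖ =
      1 - Real.exp (-∫ v in (0 : ℝ)..r₀, losRate lamb R pB ‖u‖ v) := by
  rw [B_L]
  split_ifs with h
  · rw [integral_losRate_of_le hr₀.le (by linarith)]
  · rw [integral_losRate_of_ge hlamb hR hu hpB (by linarith)]

theorem B_L_nonneg (hlamb : 0 < lamb) (hR : 0 < R) (hu : ‖u‖ ≤ R)
    (hpB : IsBlockageProfile pB) {r₀ : ℝ} (hr₀ : 0 < r₀) :
    0 ≤ B_L lamb R r₀ pB ‖u‖ := by
  rw [B_L_eq hlamb hR hu hpB hr₀, sub_nonneg, Real.exp_le_one_iff, neg_nonpos]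
  exact intervalIntegral.integral_nonneg hr₀.le fun v hv =>
    (losRate_mem_Icc hlamb hR hu hpB hv.1).1

theorem f_L_eq (hlamb : 0 < lamb) (hR : 0 < R) (hu : ‖u‖ ≤ R)
    (hpB : IsBlockageProfile pB) {r₀ l : ℝ} (hl : l ∈ Set.Icc 0 r₀) :
    f_L lamb R r₀ pB l ‖u‖ = losRate lamb R pB ‖u‖ l *
      Real.exp (-∫ v in (0 : ℝ)..l, losRate lamb R pB ‖u‖ v) / B_L lamb R r₀ pB ‖u‖ := by
  rw [f_L]
  split_ifs with h
  -- Since `l ≤ r₀`, the case `r ≤ R - r₀` is contained in `l ≤ R - r`.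
  · have hle : l ≤ R - ‖u‖ := by
      rcases h with h | h
      · linarith [hl.2]
      · exact h
    rw [integral_losRate_of_le hl.1 hle, losRate, arcProfile, if_pos hle]
    ring_nf
  · have hlt : ¬ l ≤ R - ‖u‖ := fun h' => h (Or.inr h')
    rw [integral_losRate_of_ge hlamb hR hu hpB (not_le.mp hlt).le, losRate, arcProfile,
      if_neg hlt]
    ring_nf

theorem integral_disk_losProb (hlamb : 0 < lamb) (hR : 0 < R) (hu : ‖u‖ ≤ R)
    (hpB : IsBlockageProfile pB) {t : ℝ} (ht : 0 ≤ t) :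
    ∫ x in Metric.closedBall u t, (1 - pB (dist u x))
        ∂(ENNReal.ofReal lamb • volume.restrict (Metric.closedBall (0 : Plane) R)) =
      ∫ v in (0 : ℝ)..t, losRate lamb R pB ‖u‖ v := by
  have hm : Measurable fun v => 1 - pB v := hpB.measurable.const_sub 1
  rw [Measure.restrict_smul, integral_smul_measure, ENNReal.toReal_ofReal hlamb.le, smul_eq_mul,
    integral_eq_lintegral_of_nonneg_ae, lintegral_disk_radial R t u hm]
  · unfold losRate
    rw [intervalIntegral.integral_const_mul, intervalIntegral.integral_of_le ht]
    congr 1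
    rw [integral_eq_lintegral_of_nonneg_ae]
    · congr 1
      refine setLIntegral_congr_fun measurableSet_Ioc fun v hv => ?_
      simp only [arcLengthInDisk_eq_arcProfile hR hu hv.1.le]
    · refine (ae_restrict_iff' measurableSet_Ioc).mpr (Filter.Eventually.of_forall fun v hv => ?_)
      have h1 := arcLengthInDisk_nonneg R u hv.1.le
      rw [arcLengthInDisk_eq_arcProfile hR hu hv.1.le] at h1
      exact mul_nonneg h1 (by linarith [(hpB.mem_Icc v hv.1.le).2])
    · have h := measurable_losRate hpB.measurable 1 R ‖u‖
      unfold losRate at h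
      simp only [one_mul] at h
      exact h.aestronglyMeasurable
  · exact Filter.Eventually.of_forall fun x =>
      sub_nonneg.mpr (hpB.mem_Icc _ dist_nonneg).2
  · exact (hm.comp (by fun_prop)).aestronglyMeasurable

end

/-! ### The nearest LOS distance as a random variable -/

section

variable {Ω : Type*} {N : Ω → ℕ} {X : ℕ → Ω → Plane} {LOS : ℕ → Ω → Bool}

theorem losInRange_eq_compl (u : Plane) (t : ℝ) :
    losInRange N X LOS u t =
      {ω | ∀ i < N ω, LOS i ω = true → X i ω ∉ Metric.closedBall u t}ᶜ := by
  ext ω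
  simp only [losInRange, losDistances, Set.mem_ofPred_eq, Set.mem_compl_iff, not_forall, not_not,
    Metric.mem_closedBall]
  constructor
  · rintro ⟨d, ⟨i, hi, hl, rfl⟩, hd⟩
    exact ⟨i, hi, hl, by rwa [dist_comm]⟩
  · rintro ⟨i, hi, hl, hd⟩
    exact ⟨_, ⟨i, hi, hl, rfl⟩, by rwa [dist_comm]⟩

theorem finite_losDistances (u : Plane) (ω : Ω) : (losDistances N X LOS u ω).Finite := by
  refine ((Set.finite_Iio (N ω)).image fun i => dist u (X i ω)).subset ?_
  rintro d ⟨i, hi, -, hd⟩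
  exact ⟨i, hi, hd⟩

theorem nearestLosDist_nonneg (u : Plane) (ω : Ω) : 0 ≤ nearestLosDist N X LOS u ω := by
  refine Real.sInf_nonneg ?_
  rintro d ⟨i, -, -, rfl⟩
  exact dist_nonneg

/-- On the event the set of distances is nonempty and finite, so its infimum is attained. This
reduces the conditional distribution function to void probabilities. -/
theorem losInRange_inter_nearestLosDist_le (u : Plane) (r₀ t : ℝ) :
    losInRange N X LOS u r₀ ∩ nearestLosDist N X LOS u ⁻¹' Set.Iic t =
      losInRange N X LOS u (min t r₀) := by
  ext ω
  have hfin := finite_losDistances (N := N) (X := X) (LOS := LOS) u ω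
  constructor
  · rintro ⟨⟨d, hd, hdr⟩, hD⟩
    exact ⟨_, Set.Nonempty.csInf_mem ⟨d, hd⟩ hfin,
      le_min hD ((csInf_le hfin.bddBelow hd).trans hdr)⟩
  · rintro ⟨d, hd, hdm⟩
    exact ⟨⟨d, hd, hdm.trans (min_le_right _ _)⟩,
      (csInf_le hfin.bddBelow hd).trans (hdm.trans (min_le_left _ _))⟩

variable [MeasurableSpace Ω]

theorem measurableSet_losInRange (hN : Measurable N) (hX : ∀ i, Measurable (X i))
    (hL : ∀ i, Measurable (LOS i)) (u : Plane) (t : ℝ) :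
    MeasurableSet (losInRange N X LOS u t) := by
  rw [losInRange_eq_compl]
  exact (measurableSet_forall_notMem hN hX hL Metric.isClosed_closedBall.measurableSet).compl

theorem measurable_nearestLosDist (hN : Measurable N) (hX : ∀ i, Measurable (X i))
    (hL : ∀ i, Measurable (LOS i)) (u : Plane) :
    Measurable (nearestLosDist N X LOS u) := by
  refine measurable_of_Iio fun t => ?_
  -- The second set accounts for `sInf ∅ = 0`: with no LOS station, the condition reads `0 < t`.
  have h : nearestLosDist N X LOS u ⁻¹' Set.Iio t =
      {ω | ∀ i < N ω, LOS i ω = true → X i ω ∉ Metric.ball u t}ᶜ ∪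
        ({ω | ∀ i < N ω, LOS i ω = true → X i ω ∉ Set.univ} ∩ {_ω | 0 < t}) := by
    ext ω
    have hfin := finite_losDistances (N := N) (X := X) (LOS := LOS) u ω
    simp only [Set.mem_preimage, Set.mem_Iio, Set.mem_union, Set.mem_compl_iff, Set.mem_inter_iff,
      Set.mem_ofPred_eq, not_forall, not_not, Metric.mem_ball, Set.mem_univ, not_true]
    rcases (losDistances N X LOS u ω).eq_empty_or_nonempty with he | hne
    · have hno : ∀ i < N ω, LOS i ω = true → False := fun i hi hl => by
        have : dist u (X i ω) ∈ losDistances N X LOS u ω := ⟨i, hi, hl, rfl⟩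
        rw [he] at this
        exact this
      rw [nearestLosDist, he, Real.sInf_empty]
      constructor
      · exact fun h => Or.inr ⟨hno, h⟩
      · rintro (⟨i, hi, hl, -⟩ | ⟨-, h⟩)
        · exact (hno i hi hl).elim
        · exact h
    · rw [nearestLosDist, csInf_lt_iff hfin.bddBelow hne]
      constructor
      · rintro ⟨d, ⟨i, hi, hl, rfl⟩, hd⟩
        exact Or.inl ⟨i, hi, hl, by rwa [dist_comm]⟩
      · rintro (⟨i, hi, hl, hd⟩ | ⟨hno, -⟩)
        · exact ⟨_, ⟨i, hi, hl, rfl⟩, by rwa [dist_comm]⟩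
        · obtain ⟨d, i, hi, hl, -⟩ := hne
          exact (hno i hi hl).elim
  rw [h]
  exact (measurableSet_forall_notMem hN hX hL Metric.isOpen_ball.measurableSet).compl.union
    ((measurableSet_forall_notMem hN hX hL MeasurableSet.univ).inter (MeasurableSet.const _))

/-! ### Law of the nearest LOS distance -/

variable {μ : Measure Ω} [IsProbabilityMeasure μ] {lamb R : ℝ} {pB : ℝ → ℝ} {u : Plane}

theorem measure_losInRange (hlamb : 0 < lamb) (hR : 0 < R) (hu : ‖u‖ ≤ R)
    (hpB : IsBlockageProfile pB)
    (hX : IsPoissonProcess μ N X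
      (ENNReal.ofReal lamb • volume.restrict (Metric.closedBall (0 : Plane) R)))
    (hLOS : IsIndependentMarking μ N X (fun x => 1 - pB (dist u x)) LOS) {t : ℝ} (ht : 0 ≤ t) :
    μ (losInRange N X LOS u t) =
      ENNReal.ofReal (1 - Real.exp (-∫ v in (0 : ℝ)..t, losRate lamb R pB ‖u‖ v)) := by
  have : IsFiniteMeasure (volume.restrict (Metric.closedBall (0 : Plane) R)) :=
    isFiniteMeasure_restrict.mpr measure_closedBall_lt_top.ne
  have : IsFiniteMeasure
      (ENNReal.ofReal lamb • volume.restrict (Metric.closedBall (0 : Plane) R)) :=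
    Measure.smul_finite _ ENNReal.ofReal_ne_top
  have hq : Measurable fun x : Plane => 1 - pB (dist u x) :=
    (hpB.measurable.comp (by fun_prop)).const_sub 1
  have h01 : ∀ x : Plane, 1 - pB (dist u x) ∈ Set.Icc (0 : ℝ) 1 := fun x => by
    obtain ⟨h1, h2⟩ := hpB.mem_Icc (dist u x) dist_nonneg
    constructor <;> linarith
  rw [losInRange_eq_compl, prob_compl_eq_one_sub (measurableSet_forall_notMem
    hX.measurable_number hX.measurable_point hLOS.measurable_mark
    Metric.isClosed_closedBall.measurableSet),
    hX.measure_forall_notMem hLOS hq h01 Metric.isClosed_closedBall.measurableSet,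
    integral_disk_losProb hlamb hR hu hpB ht, ENNReal.ofReal_sub _ (Real.exp_pos _).le,
    ENNReal.ofReal_one]

theorem setLIntegral_f_L (hlamb : 0 < lamb) (hR : 0 < R) (hu : ‖u‖ ≤ R)
    (hpB : IsBlockageProfile pB) {r₀ s : ℝ} (hs : s ∈ Set.Icc 0 r₀)
    (hB : 0 ≤ B_L lamb R r₀ pB ‖u‖) :
    ∫⁻ l in Set.Icc 0 s, ENNReal.ofReal (f_L lamb R r₀ pB l ‖u‖) =
      ENNReal.ofReal ((1 - Real.exp (-∫ v in (0 : ℝ)..s, losRate lamb R pB ‖u‖ v)) /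
        B_L lamb R r₀ pB ‖u‖) := by
  set k := losRate lamb R pB ‖u‖ with hk
  have hki : IntervalIntegrable k volume 0 s :=
    intervalIntegrable_losRate hlamb hR hu hpB le_rfl hs.1
  have hk0 : ∀ v ∈ Set.Icc 0 s, 0 ≤ k v := fun v hv =>
    (losRate_mem_Icc hlamb hR hu hpB hv.1).1
  have hcont : ContinuousOn (fun v => Real.exp (-∫ w in (0 : ℝ)..v, k w)) (Set.uIcc 0 s) :=
    ((hki.absolutelyContinuousOnInterval_intervalIntegral (c := 0)
      (by simp)).continuousOn).neg.rexp
  have hint : IntervalIntegrable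
      (fun v => k v * Real.exp (-∫ w in (0 : ℝ)..v, k w) / B_L lamb R r₀ pB ‖u‖) volume 0 s :=
    (hki.mul_continuousOn hcont).div_const _
  rw [← restrict_Ioc_eq_restrict_Icc, ← integral_mul_exp_neg_integral hs.1 hki hk0,
    ← intervalIntegral.integral_div, intervalIntegral.integral_of_le hs.1,
    ofReal_integral_eq_lintegral_ofReal hint.1]
  · refine setLIntegral_congr_fun measurableSet_Ioc fun v hv => ?_
    simp only [f_L_eq hlamb hR hu hpB (⟨hv.1.le, hv.2.trans hs.2⟩ : v ∈ Set.Icc 0 r₀), hk]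
  · refine (ae_restrict_iff' measurableSet_Ioc).mpr (Filter.Eventually.of_forall fun v hv => ?_)
    exact div_nonneg (mul_nonneg (hk0 v ⟨hv.1.le, hv.2⟩) (Real.exp_pos _).le) hB

/-- The law of the distance to the nearest line-of-sight base station within range. -/
theorem map_nearestLosDist (hlamb : 0 < lamb) (hR : 0 < R) (hu : ‖u‖ ≤ R)
    (hpB : IsBlockageProfile pB) {r₀ : ℝ} (hr₀ : 0 < r₀)
    (hX : IsPoissonProcess μ N X
      (ENNReal.ofReal lamb • volume.restrict (Metric.closedBall (0 : Plane) R)))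
    (hLOS : IsIndependentMarking μ N X (fun x => 1 - pB (dist u x)) LOS) :
    (μ[|losInRange N X LOS u r₀]).map (nearestLosDist N X LOS u) =
      (volume.restrict (Set.Icc 0 r₀)).withDensity
        (fun l => ENNReal.ofReal (f_L lamb R r₀ pB l ‖u‖)) := by
  have hE := measurableSet_losInRange hX.measurable_number hX.measurable_point
    hLOS.measurable_mark u r₀
  have hD := measurable_nearestLosDist hX.measurable_number hX.measurable_point
    hLOS.measurable_mark u
  have hBE : μ (losInRange N X LOS u r₀) = ENNReal.ofReal (B_L lamb R r₀ pB ‖u‖) := by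
    rw [measure_losInRange hlamb hR hu hpB hX hLOS hr₀.le, B_L_eq hlamb hR hu hpB hr₀]
  have hB0 := B_L_nonneg hlamb hR hu hpB hr₀
  rcases hB0.eq_or_lt with hB | hB
  -- If `B_L = 0`, both sides are the zero measure: conditioning on a null event gives 0, and so
  -- does division by `B_L`.
  · have hf : (fun l => ENNReal.ofReal (f_L lamb R r₀ pB l ‖u‖)) = 0 := by
      funext l
      simp [f_L, ← hB]
    rw [hf, withDensity_zero, cond_eq_zero_of_meas_eq_zero (by rw [hBE, ← hB]; simp),
      Measure.map_zero]
  · have hne : μ (losInRange N X LOS u r₀) ≠ 0 := by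
      rw [hBE]; exact (ENNReal.ofReal_pos.mpr hB).ne'
    have := cond_isProbabilityMeasure hne
    have := Measure.isProbabilityMeasure_map (μ := μ[|losInRange N X LOS u r₀]) hD.aemeasurable
    -- It suffices to compare the two measures on half-lines, that is, their distribution functions.
    refine Measure.ext_of_Iic _ _ fun t => ?_
    rw [Measure.map_apply hD measurableSet_Iic, cond_apply hE,
      withDensity_apply _ measurableSet_Iic, Measure.restrict_restrict measurableSet_Iic]
    rcases lt_or_ge t 0 with ht | ht
    · have h1 : nearestLosDist N X LOS u ⁻¹' Set.Iic t = ∅ := by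
        ext ω
        simpa using ht.trans_le (nearestLosDist_nonneg u ω)
      have h2 : Set.Iic t ∩ Set.Icc 0 r₀ = ∅ := by
        ext l
        simp only [Set.mem_inter_iff, Set.mem_Iic, Set.mem_Icc, Set.mem_empty_iff_false, iff_false]
        rintro ⟨h1, h2, -⟩
        linarith
      rw [h1, h2]
      simp
    · have h2 : Set.Iic t ∩ Set.Icc 0 r₀ = Set.Icc 0 (min t r₀) := by
        ext l
        simp only [Set.mem_inter_iff, Set.mem_Iic, Set.mem_Icc, le_min_iff]
        tauto
      have hs : min t r₀ ∈ Set.Icc 0 r₀ := ⟨le_min ht hr₀.le, min_le_right _ _⟩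
      rw [losInRange_inter_nearestLosDist_le, h2,
        measure_losInRange hlamb hR hu hpB hX hLOS hs.1,
        setLIntegral_f_L hlamb hR hu hpB hs hB0, hBE, ENNReal.ofReal_div_of_pos hB,
        ENNReal.div_eq_inv_mul]

end

end MmWave

end

theorem proposition1 {Ω : Type*} [MeasurableSpace Ω] (μ : Measure Ω) [IsProbabilityMeasure μ]
    (lamb R r₀ : ℝ) (hlamb : 0 < lamb) (hR : 0 < R) (hr₀ : 0 < r₀)
    (pB : ℝ → ℝ) (hpB : MmWave.IsBlockageProfile pB)
    (u : MmWave.Plane) (hu : u ∈ Metric.closedBall (0 : MmWave.Plane) R)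
    (r : ℝ) (hr : r = ‖u‖)
    (N : Ω → ℕ) (X : ℕ → Ω → MmWave.Plane) (LOS : ℕ → Ω → Bool)
    (hX : MmWave.IsPoissonProcess μ N X
      (ENNReal.ofReal lamb • volume.restrict (Metric.closedBall (0 : MmWave.Plane) R)))
    (hLOS : MmWave.IsIndependentMarking μ N X (fun x => 1 - pB (dist u x)) LOS) :
    -- the probability of a line-of-sight base station within range
    μ.real (MmWave.losInRange N X LOS u r₀) = MmWave.B_L lamb R r₀ pB r ∧
    -- the law of the distance to the nearest one, given that there is one within range
    (μ[|MmWave.losInRange N X LOS u r₀]).map (MmWave.nearestLosDist N X LOS u) =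
      (volume.restrict (Set.Icc 0 r₀)).withDensity
        (fun l => ENNReal.ofReal (MmWave.f_L lamb R r₀ pB l r)) ∧
    -- the length of the part of the circle around the user that lies in the disk
    (∀ l, 0 ≤ l → l ≤ R - r → MmWave.arcLengthInDisk R u l = 2 * Real.pi * l) ∧
    (∀ l, R - r < l → MmWave.arcLengthInDisk R u l = MmWave.C R l r) ∧
    -- the intersection points of the two circles, and the angle between the lines to them
    (∀ l, R - r < l → l < R + r →
      Metric.sphere (0 : MmWave.Plane) R ∩ Metric.sphere (!₂[0, r] : MmWave.Plane) l =
        {!₂[MmWave.x₁ R l r, MmWave.y₁₂ R l r], !₂[MmWave.x₂ R l r, MmWave.y₁₂ R l r]} ∧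
      MmWave.theta R l r ∈ Set.Ioo 0 (2 * Real.pi) ∧
      (1 + MmWave.m₁ R l r * MmWave.m₂ R l r ≠ 0 →
        Real.tan (MmWave.theta R l r) =
          (MmWave.m₁ R l r - MmWave.m₂ R l r) / (1 + MmWave.m₁ R l r * MmWave.m₂ R l r))) := by
  subst hr
  have hu' : ‖u‖ ≤ R := mem_closedBall_zero_iff.mp hu
  refine ⟨?_, MmWave.map_nearestLosDist hlamb hR hu' hpB hr₀ hX hLOS,
    fun l h0 h => MmWave.arcLengthInDisk_of_le h0 h,
    fun l h => MmWave.arcLengthInDisk_of_lt hR hu' h, fun l h1 h2 => ?_⟩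
  · rw [measureReal_def, MmWave.measure_losInRange hlamb hR hu' hpB hX hLOS hr₀.le,
      ← MmWave.B_L_eq hlamb hR hu' hpB hr₀,
      ENNReal.toReal_ofReal (MmWave.B_L_nonneg hlamb hR hu' hpB hr₀)]
  -- The range `R - r < l < R + r` is empty unless `r > 0`.
  · have hr : 0 < ‖u‖ := by linarith
    exact ⟨MmWave.sphere_inter_sphere hr hu' h1 h2, MmWave.theta_mem_Ioo h2,
      fun _ => MmWave.tan_theta h2⟩
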